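/- All graphs are finite and simple. A graph is \emph{hamiltonian} if it has a cycle through all of its vertices, and \emph{traceable} if it has a path through all of its vertices. A graph $G$ is \emph{maximal nonhamiltonian} if it is not hamiltonian but $G+e$ is hamiltonian for every edge $e$ of the complement $\overline{G}$; it is \emph{maximal nontraceable} if it is not traceable but $G+e$ is traceable for every edge $e$ of $\overline{G}$. A graph $G$ is \emph{hypohamiltonian} if it is not hamiltonian but $G-v$ is hamiltonian for every vertex $v$, and \emph{maximal hypohamiltonian} if it is both maximal nonhamiltonian and hypohamiltonian. For $i=1,2,3$ let $H_i$ be a cubic maximal hypohamiltonian graph with a vertex $z_i$ whose neighbours are $a_i,b_i,c_i$, and assume \textbf{Condition (C):} for every vertex $u\neq z_i$ of $H_i$ that is not adjacent to $z_i$, the graph $H_i+z_iu$ has a hamiltonian cycle containing the edge $a_iz_i$ as well as a hamiltonian cycle not containing the edge $a_iz_i$. Let $K_4[H_1,H_2,H_3]$ be the graph obtained from the disjoint union of $H_1-z_1$, $H_2-z_2$, $H_3-z_3$ and a new vertex $x$ by adding the six edges $$xa_1,\quad xa_2,\quad xa_3,\quad c_1b_2,\quad c_2b_3,\quad c_3b_1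 .$$ \textbf{Theorem.} The graph $K_4[H_1,H_2,H_3]$ is cubic and maximal nontraceable. -/

import Mathlib

section Basic

variable {V : Type*}

/-- A graph is traceable if it has a hamiltonian path. -/
def SimpleGraph.IsTraceable [DecidableEq V] (G : SimpleGraph V) : Prop :=
  ∃ (u v : V) (p : G.Walk u v), p.IsHamiltonian

/-- A graph is maximal nonhamiltonian (MNH) if it is not hamiltonian, but adding any edge of
its complement makes it hamiltonian. -/
def SimpleGraph.IsMaximalNonhamiltonian [Fintype V] [DecidableEq V] (G : SimpleGraph V) : Prop :=
  ¬ G.IsHamiltonian ∧ ∀ u v : V, Gᶜ.Adj u v → (G ⊔ SimpleGraph.edge u v).IsHamiltonian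

/-- A graph is maximal nontraceable (MNT) if it is not traceable, but adding any edge of
its complement makes it traceable. -/
def SimpleGraph.IsMaximalNontraceable [DecidableEq V] (G : SimpleGraph V) : Prop :=
  ¬ G.IsTraceable ∧ ∀ u v : V, Gᶜ.Adj u v → (G ⊔ SimpleGraph.edge u v).IsTraceable

/-- A graph is hypohamiltonian if it is not hamiltonian, but every vertex-deleted subgraph is. -/
def SimpleGraph.IsHypohamiltonian [Fintype V] [DecidableEq V] (G : SimpleGraph V) : Prop :=
  ¬ G.IsHamiltonian ∧ ∀ v : V, (G.induce {w | w ≠ v}).IsHamiltonian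

/-- A graph is maximal hypohamiltonian (MHH) if it is MNH and hypohamiltonian. -/
def SimpleGraph.IsMaximalHypohamiltonian [Fintype V] [DecidableEq V]
    (G : SimpleGraph V) : Prop :=
  G.IsMaximalNonhamiltonian ∧ G.IsHypohamiltonian

open Classical in
/-- A cubic finite graph: every vertex has degree 3. -/
def SimpleGraph.IsCubic [Fintype V] (G : SimpleGraph V) : Prop :=
  G.IsRegularOfDegree 3

/-- Condition (C) for the vertex `z` and its chosen neighbour `a`: for every vertex `u` that is
not adjacent (and not equal) to `z`, the graph `H + zu` has a hamiltonian cycle containing the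
edge `az`, as well as a hamiltonian cycle not containing `az`. -/
def SimpleGraph.ConditionC [DecidableEq V] (H : SimpleGraph V) (z a : V) : Prop :=
  ∀ u : V, u ≠ z → u ∉ H.neighborSet z →
    (∃ (w : V) (p : (H ⊔ SimpleGraph.edge z u).Walk w w),
      p.IsHamiltonianCycle ∧ s(a, z) ∈ p.edges) ∧
    (∃ (w : V) (p : (H ⊔ SimpleGraph.edge z u).Walk w w),
      p.IsHamiltonianCycle ∧ s(a, z) ∉ p.edges)

end Basic

section Construction

variable {V : Fin 3 → Type*}

/-- Vertices of the inflated `K₄`: the new vertex `x`, given by `none`, together with the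
disjoint union of the vertex sets of the graphs `Fᵢ = Hᵢ - zᵢ`. -/
abbrev InflatedK4Vertex (z : ∀ i, V i) :=
  Option (Σ i : Fin 3, {v : V i // v ≠ z i})

/-- The edges of the inflated `K₄`, each listed in at least one direction. The index `i + 1` is
taken modulo 3. -/
inductive InflatedK4Rel (H : ∀ i, SimpleGraph (V i)) (z a b c : ∀ i, V i) :
    InflatedK4Vertex z → InflatedK4Vertex z → Prop
  /-- the edges of `Fᵢ` -/
  | inner (i : Fin 3) (v w : {v : V i // v ≠ z i}) (h : (H i).Adj v w) :
      InflatedK4Rel H z a b c (some ⟨i, v⟩) (some ⟨i, w⟩)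
  /-- the vertex `x` is joined to `aᵢ` -/
  | spoke (i : Fin 3) (h : a i ≠ z i) :
      InflatedK4Rel H z a b c none (some ⟨i, a i, h⟩)
  /-- `cᵢ` is joined to `bᵢ₊₁` -/
  | link (i : Fin 3) (h : c i ≠ z i) (h' : b (i + 1) ≠ z (i + 1)) :
      InflatedK4Rel H z a b c (some ⟨i, c i, h⟩) (some ⟨i + 1, b (i + 1), h'⟩)

/-- The inflated `K₄` built from the graphs `Hᵢ` opened up at `zᵢ`, where `aᵢ`, `bᵢ`, `cᵢ` are
the neighbours of `zᵢ` in `Hᵢ`. -/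
def inflatedK4 (H : ∀ i, SimpleGraph (V i)) (z a b c : ∀ i, V i) :
    SimpleGraph (InflatedK4Vertex z) :=
  SimpleGraph.fromRel (InflatedK4Rel H z a b c)

end Construction

/-! Write F_i = H_i - z_i and call a_i, b_i, c_i its terminals: exactly three edges leave F_i, one
at each terminal.

Nontraceability: a hamiltonian path has only two ends, so some F_i contains neither. Each visit of
the path to F_i enters and leaves at distinct terminals, so three terminals permit a single visit
(`exists_segment`). That visit is a hamiltonian path of F_i between two neighbours of z_i, and
closing it through z_i makes H_i hamiltonian, a contradiction (`IsOpening.not_isTraceable`).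

Maximality: hypohamiltonicity gives F_i a hamiltonian path starting at any vertex (delete z_i), and
gives F_i minus any terminal a hamiltonian path joining the other two (delete that terminal); this
is `IsPiece`. If the added edge lies inside F_i, maximal nonhamiltonicity of H_i yields a
hamiltonian path of F_i plus that edge between two terminals. If it leaves F_i at a nonterminal u,
Condition (C) yields hamiltonian paths of F_i from u to a_i and from u to b_i or c_i
(`ConditionC.exists_hasPath`). In each case, and when the added edge joins terminals or joins x to a
terminal, these paths are strung together along the K_4 pattern of `IsK4Frame`. -/

namespace SimpleGraph

/-! ### Walks with prescribed vertex multiset, and hamiltonian cycles cut open at a vertex -/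

section HasPath

variable {V W : Type*} {G : SimpleGraph V}

/-- There is a walk from `u` to `v` whose vertices, with multiplicity, are those of `m`. -/
def HasPath (G : SimpleGraph V) (m : Multiset V) (u v : V) : Prop :=
  ∃ p : G.Walk u v, (p.support : Multiset V) = m

namespace HasPath

variable {m m' : Multiset V} {u v w t : V}

theorem single (G : SimpleGraph V) (u : V) : G.HasPath {u} u u := ⟨.nil, rfl⟩

theorem trans (h : G.HasPath m u v) (hadj : G.Adj v w) (h' : G.HasPath m' w t) :
    G.HasPath (m + m') u t := by
  obtain ⟨p, rfl⟩ := h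
  obtain ⟨q, rfl⟩ := h'
  exact ⟨p.append (.cons hadj q), by simp [Walk.support_append]⟩

theorem symm (h : G.HasPath m u v) : G.HasPath m v u := by
  obtain ⟨p, rfl⟩ := h
  exact ⟨p.reverse, by simp⟩

theorem map {G' : SimpleGraph W} (f : V → W)
    (hf : ∀ x ∈ m, ∀ y ∈ m, G.Adj x y → G'.Adj (f x) (f y)) (h : G.HasPath m u v) :
    G'.HasPath (m.map f) (f u) (f v) := by
  obtain ⟨p, rfl⟩ := h
  induction p with
  | nil => exact single G' _
  | cons hadj p ih =>
    obtain ⟨q, hq⟩ := ih fun x hx y hy => hf x (by simp_all) y (by simp_all)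
    refine ⟨.cons (hf _ (by simp) _ (by simp) hadj) q, ?_⟩
    rw [Walk.support_cons, Walk.support_cons, ← Multiset.cons_coe, ← Multiset.cons_coe,
      Multiset.map_cons, hq]

theorem imp {G' : SimpleGraph V} (hf : ∀ x ∈ m, ∀ y ∈ m, G.Adj x y → G'.Adj x y)
    (h : G.HasPath m u v) : G'.HasPath m u v := by
  simpa using h.map id hf

theorem mono {G' : SimpleGraph V} (hG : G ≤ G') (h : G.HasPath m u v) : G'.HasPath m u v :=
  h.imp fun _ _ _ _ hxy => hG hxy

theorem isTraceable [Fintype V] [DecidableEq V] (h : G.HasPath Finset.univ.val u v) :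
    G.IsTraceable := by
  obtain ⟨p, hp⟩ := h
  refine ⟨u, v, p, fun x => ?_⟩
  rw [← Multiset.coe_count, hp]
  exact Multiset.count_eq_one_of_mem Finset.univ.nodup (Finset.mem_univ x)

end HasPath

variable [Fintype V] [DecidableEq V]

theorem Walk.IsHamiltonian.coe_support {u v : V} {p : G.Walk u v} (hp : p.IsHamiltonian) :
    (p.support : Multiset V) = Finset.univ.val := by
  refine (Multiset.Nodup.ext (Multiset.coe_nodup.2 hp.isPath.support_nodup)
    Finset.univ.nodup).2 fun x => ?_
  simp [hp.mem_support x]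

/-- Rotate the cycle to `z` and strip its first and last edges. The final clause records which edges
at `z` the cycle uses; Condition (C) is exploited through it. -/
theorem Walk.IsHamiltonianCycle.exists_hasPath {w : V} {p : G.Walk w w}
    (hp : p.IsHamiltonianCycle) (z : V) :
    ∃ s t, s ≠ t ∧ G.Adj z s ∧ G.Adj z t ∧ G.HasPath (Finset.univ.val.erase z) s t ∧
      ∀ y, s(y, z) ∈ p.edges ↔ y = s ∨ y = t := by
  have hz := hp.mem_support z
  have hmem : ∀ e, e ∈ p.edges ↔ e ∈ (p.rotate z hz).edges := fun e =>
    ((p.rotate_edges z hz).mem_iff).symm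
  simp only [hmem]
  replace hp := hp.rotate hz
  generalize p.rotate z hz = p at hp
  cases p with
  | nil => exact absurd rfl hp.ne_nil
  | @cons _ s _ hs q =>
    have hq : q.IsHamiltonian :=
      (Walk.isHamiltonianCycle_iff_isCycle_and_support_count_tail_eq_one.1 hp).2
    have hcyc := (Walk.cons_isCycle_iff q hs).1 hp.isCycle
    -- Reversing the rest of the cycle turns its last edge into a first edge, which `cases` can peel
    -- off.
    obtain ⟨r, rfl⟩ : ∃ r : G.Walk z s, q = r.reverse := ⟨q.reverse, by simp⟩
    cases r with
    | nil => exact absurd rfl hs.ne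
    | @cons _ t _ ht r =>
      have hr : (r.support : Multiset V) = Finset.univ.val.erase z := by
        rw [← hq.coe_support, Walk.support_reverse, Multiset.coe_reverse, Walk.support_cons,
          ← Multiset.cons_coe, Multiset.erase_cons_head]
      have hzr : z ∉ r.support := by
        rw [← Multiset.mem_coe, hr]
        exact Finset.univ.nodup.notMem_erase
      refine ⟨s, t, ?_, hs, ht, HasPath.symm ⟨r, hr⟩, fun y => ?_⟩
      · rintro rfl
        simp at hcyc
      · have : s(y, z) ∉ r.edges := fun h => hzr (r.snd_mem_support_of_mem_edges h)
        have hys : s(y, z) = s(z, s) ↔ y = s := by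
          rw [Sym2.eq_swap, Sym2.congr_right]
        have hyt : s(y, z) = s(z, t) ↔ y = t := by
          rw [Sym2.eq_swap, Sym2.congr_right]
        rw [Walk.edges_cons, Walk.edges_reverse, Walk.edges_cons]
        simp only [List.mem_cons, List.mem_reverse, hys, hyt, this, or_false]

theorem HasPath.isHamiltonian {z s t : V} (hs : G.Adj z s) (ht : G.Adj z t) (hst : s ≠ t)
    (h : G.HasPath (Finset.univ.val.erase z) s t) : G.IsHamiltonian := by
  obtain ⟨p, hp⟩ := h
  have hzp : z ∉ p.support := by
    rw [← Multiset.mem_coe, hp]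
    exact Finset.univ.nodup.notMem_erase
  have hnd : p.support.Nodup := by
    rw [← Multiset.coe_nodup, hp]
    exact Finset.univ.nodup.erase _
  let q : G.Walk z t := .cons hs p
  have hq : q.IsPath := by
    rw [Walk.isPath_def]
    simp [q, hzp, hnd]
  have hqH : q.IsHamiltonian := by
    refine hq.isHamiltonian_of_mem fun x => ?_
    by_cases hx : x = z
    · simp [q, hx]
    · have : x ∈ (p.support : Multiset V) := by
        rw [hp, Multiset.mem_erase_of_ne hx]; simp
      simpa [q, hx] using this
  refine fun _ => ⟨t, .cons ht.symm q, ?_⟩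
  rw [Walk.isHamiltonianCycle_iff_isCycle_and_support_count_tail_eq_one]
  refine ⟨(Walk.cons_isCycle_iff _ _).2 ⟨hq, ?_⟩, hqH⟩
  intro hmem
  rw [Walk.edges_cons, List.mem_cons] at hmem
  rcases hmem with hmem | hmem
  · rw [Sym2.eq_swap, Sym2.congr_right] at hmem
    exact hst hmem.symm
  · exact hzp (p.snd_mem_support_of_mem_edges hmem)

theorem val_univ_subtype_ne (r : V) :
    (Finset.univ : Finset {w // w ≠ r}).val.map Subtype.val = Finset.univ.val.erase r := by
  refine (Multiset.Nodup.ext (Finset.univ.nodup.map Subtype.val_injective)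
    (Finset.univ.nodup.erase _)).2 fun x => ?_
  rw [Finset.univ.nodup.mem_erase_iff]
  simp

/-- A hamiltonian cycle of `G - r` gives a hamiltonian path of `G - r - z`. -/
theorem exists_hasPath_of_induce_ne (hcard : 3 ≤ Fintype.card V) {r z : V} (hzr : z ≠ r)
    (h : (G.induce {w | w ≠ r}).IsHamiltonian) :
    ∃ s t, s ≠ t ∧ s ≠ r ∧ t ≠ r ∧ G.Adj z s ∧ G.Adj z t ∧
      G.HasPath ((Finset.univ.val.erase z).erase r) s t := by
  -- `IsHamiltonian` holds by convention for a one-vertex graph, so a cycle is available only once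
  -- this case is excluded.
  have hc : Fintype.card {w | w ≠ r} ≠ 1 := by
    have : Fintype.card {w // w ≠ r} = Fintype.card V - 1 := by
      simp
    intro h1
    have h2 : Fintype.card {w // w ≠ r} = 1 := by
      rw [← h1]; exact Fintype.card_congr (Equiv.refl _)
    omega
  obtain ⟨w, p, hp⟩ := h hc
  obtain ⟨s, t, hst, hs, ht, hP, -⟩ := hp.exists_hasPath ⟨z, hzr⟩
  refine ⟨s, t, fun h => hst (Subtype.ext h), s.2, t.2, hs, ht, ?_⟩
  have := hP.map (G' := G) Subtype.val fun x _ y _ hxy => hxy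
  have hm : ((Finset.univ.val.erase (⟨z, hzr⟩ : {w | w ≠ r})).map Subtype.val)
      = (Finset.univ.val.erase z).erase r := by
    rw [Multiset.map_erase _ Subtype.val_injective, Multiset.erase_comm]
    congr 1
    rw [← val_univ_subtype_ne r]
    congr!
  rwa [hm] at this

/-- A hamiltonian cycle of `G - r` gives a hamiltonian path of `G - r` starting anywhere. -/
theorem exists_hasPath_erase (hcard : 3 ≤ Fintype.card V) {r s : V} (hsr : s ≠ r)
    (h : (G.induce {w | w ≠ r}).IsHamiltonian) :
    ∃ t, G.HasPath (Finset.univ.val.erase r) s t := by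
  obtain ⟨p, q, -, hpr, -, hp, -, hP⟩ := exists_hasPath_of_induce_ne hcard hsr h
  refine ⟨q, ?_⟩
  have := (HasPath.single G s).trans hp hP
  rwa [Multiset.erase_comm, Multiset.singleton_add, Multiset.cons_erase] at this
  rw [Multiset.mem_erase_of_ne hsr]; simp

end HasPath

/-! ### Paths crossing a three-edge cut -/

section Blocks

variable {α : Type*}

theorem _root_.List.exists_eq_append_cons_of_exists_mem {P : α → Prop} {l : List α}
    (h : ∃ x ∈ l, P x) : ∃ l₁ p r, l = l₁ ++ p :: r ∧ P p ∧ ∀ y ∈ l₁, ¬ P y := by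
  induction l with
  | nil => simp at h
  | cons x l ih =>
    by_cases hx : P x
    · exact ⟨[], x, l, rfl, hx, by simp⟩
    · obtain ⟨l₁, p, r, rfl, hp, hl⟩ := ih (by simpa [hx] using h)
      exact ⟨x :: l₁, p, r, rfl, hp, by simpa [hx] using hl⟩

/-- The first maximal block of elements satisfying `P` in a list whose ends do not. -/
theorem _root_.List.exists_block {P : α → Prop} {l : List α} (hne : l ≠ [])
    (hhead : ¬ P (l.head hne)) (hlast : ¬ P (l.getLast hne)) (h : ∃ x ∈ l, P x) :
    ∃ l₁ u s w r, l = l₁ ++ u :: (s ++ w :: r) ∧ s ≠ [] ∧ (∀ y ∈ s, P y) ∧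
      (∀ y ∈ l₁, ¬ P y) ∧ ¬ P u ∧ ¬ P w := by
  obtain ⟨l₁, p, r, rfl, hp, hl₁⟩ := List.exists_eq_append_cons_of_exists_mem h
  have h2 : ∃ x ∈ p :: r, ¬ P x := by
    refine ⟨_, ?_, hlast⟩
    rw [List.getLast_append_of_ne_nil _ (List.cons_ne_nil p r)]
    exact List.getLast_mem _
  obtain ⟨s, w, r', hr, hw, hs⟩ := List.exists_eq_append_cons_of_exists_mem h2
  rcases List.eq_nil_or_concat l₁ with rfl | ⟨l₂, u, rfl⟩
  · exact absurd hp hhead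
  · refine ⟨l₂, u, s, w, r', by simp [hr], ?_, fun y hy => not_not.1 (hs y hy),
      fun y hy => hl₁ y (by simp [hy]), hl₁ u (by simp), hw⟩
    rintro rfl
    simp only [List.nil_append, List.cons.injEq] at hr
    exact hw (hr.1 ▸ hp)

variable {G : SimpleGraph α}

/-- If the first and last vertices of the block coincided, that vertex would have both `u` and `w`
as neighbours outside `P`, against `hout`. -/
theorem exists_ends_of_block {P : α → Prop} {T : Set α}
    (hT : ∀ p y, P p → ¬ P y → G.Adj p y → p ∈ T)
    (hout : ∀ p y y', P p → ¬ P y → ¬ P y' → G.Adj p y → G.Adj p y' → y = y')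
    {u w : α} {s : List α} (hs : s ≠ []) (hP : ∀ y ∈ s, P y) (hu : ¬ P u) (hw : ¬ P w)
    (huw : u ≠ w) (hch : (u :: (s ++ [w])).IsChain G.Adj) :
    s.head hs ∈ T ∧ s.getLast hs ∈ T ∧ s.head hs ≠ s.getLast hs := by
  have h1 : G.Adj u (s.head hs) := by
    cases s with
    | nil => exact absurd rfl hs
    | cons p s => exact hch.rel
  have h2 : G.Adj (s.getLast hs) w := by
    have := hch.of_cons
    exact (List.isChain_append.1 this).2.2 _ (by simp [List.getLast?_eq_getLast_of_ne_nil hs])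
      _ (by simp)
  have p1 := hP _ (List.head_mem hs)
  have p2 := hP _ (List.getLast_mem hs)
  refine ⟨hT _ _ p1 hu h1.symm, hT _ _ p2 hw h2, fun h => huw ?_⟩
  exact hout _ _ _ p1 hu hw h1.symm (h ▸ h2)

/-- A path with both ends outside a set `P` joined to its complement by a matching with three
edges meets `P` in a single segment. -/
theorem exists_segment {P : α → Prop} {a b c : α}
    (hT : ∀ p y, P p → ¬ P y → G.Adj p y → p ∈ ({a, b, c} : Set α))
    (hout : ∀ p y y', P p → ¬ P y → ¬ P y' → G.Adj p y → G.Adj p y' → y = y')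
    {l : List α} (hch : l.IsChain G.Adj) (hnd : l.Nodup) (hne : l ≠ [])
    (hhead : ¬ P (l.head hne)) (hlast : ¬ P (l.getLast hne)) (h : ∃ x ∈ l, P x) :
    ∃ (s : List α) (hs : s ≠ []), s.IsChain G.Adj ∧ s.Nodup ∧ (∀ y, y ∈ s ↔ y ∈ l ∧ P y) ∧
      s.head hs ∈ ({a, b, c} : Set α) ∧ s.getLast hs ∈ ({a, b, c} : Set α) ∧
      s.head hs ≠ s.getLast hs := by
  obtain ⟨l₁, u, s, w, r, rfl, hs, hPs, hl₁, hu, hw⟩ := List.exists_block hne hhead hlast h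
  have hchs : (u :: (s ++ [w])).IsChain G.Adj :=
    hch.infix ⟨l₁, r, by simp⟩
  have huw : u ≠ w := by
    rintro rfl
    simp [List.nodup_append] at hnd
  have hends := exists_ends_of_block hT hout hs hPs hu hw huw hchs
  refine ⟨s, hs, hch.infix ⟨l₁ ++ [u], w :: r, by simp⟩,
    hnd.sublist (List.IsInfix.sublist ⟨l₁ ++ [u], w :: r, by simp⟩), fun y => ?_, hends⟩
  constructor
  · exact fun hy => ⟨by simp [hy], hPs y hy⟩
  rintro ⟨hy, hPy⟩
  by_contra hys
  have hyr : ∃ x ∈ w :: r, P x := by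
    refine ⟨y, ?_, hPy⟩
    simp only [List.mem_append, List.mem_cons] at hy ⊢
    rcases hy with hy | rfl | hy | hy
    · exact absurd hPy (hl₁ y hy)
    · exact absurd hPy hu
    · exact absurd hy hys
    · exact hy
  have hlast' : ¬ P ((w :: r).getLast (List.cons_ne_nil w r)) := by
    simpa [List.getLast_append_of_ne_nil] using hlast
  -- A second block would have two distinct terminals as ends, both different from those of the
  -- first block: four distinct elements of `{a, b, c}`.
  obtain ⟨l₂, u', s', w', r', hr, hs', hPs', -, hu', hw'⟩ :=
    List.exists_block (List.cons_ne_nil w r) (by simpa using hw) hlast' hyr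
  rw [hr] at hch hnd
  have hchs' : (u' :: (s' ++ [w'])).IsChain G.Adj :=
    hch.infix ⟨l₁ ++ u :: s ++ l₂, r', by simp⟩
  have huw' : u' ≠ w' := by
    rintro rfl
    simp [List.nodup_append] at hnd
  obtain ⟨e1, e2, e3⟩ := hends
  obtain ⟨e1', e2', e3'⟩ := exists_ends_of_block hT hout hs' hPs' hu' hw' huw' hchs'
  have hdisj : ∀ x ∈ s, ∀ y ∈ s', x ≠ y := by
    rintro x hx _ hy rfl
    simp only [List.nodup_append, List.nodup_cons, List.mem_append, List.mem_cons] at hnd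
    exact hnd.2.1.2.2.2 x hx x (by simp [hy]) rfl
  have d1 := hdisj _ (List.head_mem hs) _ (List.head_mem hs')
  have d2 := hdisj _ (List.head_mem hs) _ (List.getLast_mem hs')
  have d3 := hdisj _ (List.getLast_mem hs) _ (List.head_mem hs')
  have d4 := hdisj _ (List.getLast_mem hs) _ (List.getLast_mem hs')
  generalize s.head hs = x1 at *
  generalize s.getLast hs = x2 at *
  generalize s'.head hs' = x3 at *
  generalize s'.getLast hs' = x4 at *
  simp only [Set.mem_insert_iff, Set.mem_singleton_iff] at e1 e2 e1' e2'
  clear hdisj hchs hchs' hch hnd hPs hPs' hr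
  grind only

end Blocks

end SimpleGraph

/-! ### Assembling hamiltonian paths from three pieces in a K_4 pattern -/

namespace SimpleGraph

variable {X : Type*} {K : SimpleGraph X}

/-- The part `M` of `K`, with terminals `a`, `b`, `c`, has a hamiltonian path starting anywhere,
and for each terminal a hamiltonian path of the rest joining the other two terminals. -/
structure IsPiece (K : SimpleGraph X) (M : Multiset X) (a b c : X) : Prop where
  start : ∀ p ∈ M, ∃ q, K.HasPath M p q
  path_ab : ∃ m, {c} + m = M ∧ K.HasPath m a b
  path_ac : ∃ m, {b} + m = M ∧ K.HasPath m a c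
  path_bc : ∃ m, {a} + m = M ∧ K.HasPath m b c

namespace IsPiece

variable {M : Multiset X} {a b c : X}

theorem mono {K' : SimpleGraph X} (hK : K ≤ K') (h : K.IsPiece M a b c) :
    K'.IsPiece M a b c where
  start p hp := (h.start p hp).imp fun _ hP => hP.mono hK
  path_ab := h.path_ab.imp fun _ hP => ⟨hP.1, hP.2.mono hK⟩
  path_ac := h.path_ac.imp fun _ hP => ⟨hP.1, hP.2.mono hK⟩
  path_bc := h.path_bc.imp fun _ hP => ⟨hP.1, hP.2.mono hK⟩

theorem mem_a (h : K.IsPiece M a b c) : a ∈ M := by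
  obtain ⟨m, rfl, -⟩ := h.path_bc
  simp

theorem mem_b (h : K.IsPiece M a b c) : b ∈ M := by
  obtain ⟨m, rfl, -⟩ := h.path_ac
  simp

theorem mem_c (h : K.IsPiece M a b c) : c ∈ M := by
  obtain ⟨m, rfl, -⟩ := h.path_ab
  simp

end IsPiece

/-- The vertices of `K` are split into three pieces and the vertex `x`, joined to each other
along the edges of a complete graph on four vertices. -/
structure IsK4Frame [Fintype X] (K : SimpleGraph X) (x : X) (M : Fin 3 → Multiset X)
    (a b c : Fin 3 → X) : Prop where
  piece : ∀ i, K.IsPiece (M i) (a i) (b i) (c i)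
  spoke : ∀ i, K.Adj x (a i)
  link : ∀ i, K.Adj (c i) (b (i + 1))
  cover : ∀ i, {x} + M i + M (i + 1) + M (i + 2) = Finset.univ.val

namespace IsK4Frame

open HasPath

variable [Fintype X] [DecidableEq X] {x : X} {M : Fin 3 → Multiset X} {a b c : Fin 3 → X}

omit [DecidableEq X] in
theorem mono {K' : SimpleGraph X} (hK : K ≤ K') (h : K.IsK4Frame x M a b c) :
    K'.IsK4Frame x M a b c where
  piece i := (h.piece i).mono hK
  spoke i := hK (h.spoke i)
  link i := hK (h.link i)
  cover := h.cover

omit [DecidableEq X] in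
theorem link₁ (h : K.IsK4Frame x M a b c) (i : Fin 3) : K.Adj (c (i + 1)) (b (i + 2)) := by
  have := h.link (i + 1)
  rwa [show i + 1 + 1 = i + 2 by omega] at this

omit [DecidableEq X] in
theorem link₂ (h : K.IsK4Frame x M a b c) (i : Fin 3) : K.Adj (c (i + 2)) (b i) := by
  have := h.link (i + 2)
  rwa [show i + 2 + 1 = i by omega] at this

variable (h : K.IsK4Frame x M a b c) (i : Fin 3)
include h

/-- Vertices are counted with multiplicity, so checking that an assembled walk is a hamiltonian path
is an identity of multiset sums, settled by `abel`. -/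
theorem isTraceable {m : Multiset X} {u v : X} (hP : K.HasPath m u v)
    (hm : m = {x} + M i + M (i + 1) + M (i + 2)) : K.IsTraceable := by
  rw [h.cover i] at hm
  exact (hm ▸ hP).isTraceable

/-- The piece is crossed in the middle; the other two carry the ends of the path, so `start`
suffices for them. -/
theorem isTraceable_of_hasPath_ab (hP : K.HasPath (M i) (a i) (b i)) : K.IsTraceable := by
  obtain ⟨_, Q⟩ := (h.piece (i + 1)).start _ (h.piece (i + 1)).mem_a
  obtain ⟨_, R⟩ := (h.piece (i + 2)).start _ (h.piece (i + 2)).mem_c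
  refine h.isTraceable i (((Q.symm.trans (h.spoke (i + 1)).symm (single K x)).trans
    (h.spoke i) hP).trans (h.link₂ i).symm R) ?_
  abel

theorem isTraceable_of_hasPath_ac (hP : K.HasPath (M i) (a i) (c i)) : K.IsTraceable := by
  obtain ⟨_, Q⟩ := (h.piece (i + 2)).start _ (h.piece (i + 2)).mem_a
  obtain ⟨_, R⟩ := (h.piece (i + 1)).start _ (h.piece (i + 1)).mem_b
  refine h.isTraceable i (((Q.symm.trans (h.spoke (i + 2)).symm (single K x)).trans
    (h.spoke i) hP).trans (h.link i) R) ?_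
  abel

/-- Here `x` has to connect the other two pieces. Each is crossed from `a` to `b` without its `c`,
and the two omitted vertices `c (i + 2)` and `c (i + 1)` become the ends of the path. -/
theorem isTraceable_of_hasPath_bc (hP : K.HasPath (M i) (b i) (c i)) : K.IsTraceable := by
  obtain ⟨m, hm, Q⟩ := (h.piece (i + 1)).path_ab
  obtain ⟨n, hn, R⟩ := (h.piece (i + 2)).path_ab
  refine h.isTraceable i (((((single K _).trans (h.link₂ i) hP).trans (h.link i) Q.symm).trans
    (h.spoke (i + 1)).symm (single K x)).trans (h.spoke (i + 2)) R |>.trans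
    (h.link₁ i).symm (single K _)) ?_
  rw [← hm, ← hn]
  abel

theorem isTraceable_of_hasPath {u v : X} (huv : u ≠ v) (hu : u = a i ∨ u = b i ∨ u = c i)
    (hv : v = a i ∨ v = b i ∨ v = c i) (hP : K.HasPath (M i) u v) : K.IsTraceable := by
  rcases hu with rfl | rfl | rfl <;> rcases hv with rfl | rfl | rfl
  · exact absurd rfl huv
  · exact h.isTraceable_of_hasPath_ab i hP
  · exact h.isTraceable_of_hasPath_ac i hP
  · exact h.isTraceable_of_hasPath_ab i hP.symm
  · exact absurd rfl huv
  · exact h.isTraceable_of_hasPath_bc i hP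
  · exact h.isTraceable_of_hasPath_ac i hP.symm
  · exact h.isTraceable_of_hasPath_bc i hP.symm
  · exact absurd rfl huv

theorem isTraceable_of_adj_x {u v : X} (hadj : K.Adj x u) (hv : v = b i ∨ v = c i)
    (hP : K.HasPath (M i) u v) : K.IsTraceable := by
  rcases hv with rfl | rfl
  · obtain ⟨_, Q⟩ := (h.piece (i + 1)).start _ (h.piece (i + 1)).mem_a
    obtain ⟨_, R⟩ := (h.piece (i + 2)).start _ (h.piece (i + 2)).mem_c
    refine h.isTraceable i (((Q.symm.trans (h.spoke (i + 1)).symm (single K x)).trans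
      hadj hP).trans (h.link₂ i).symm R) ?_
    abel
  · obtain ⟨_, Q⟩ := (h.piece (i + 2)).start _ (h.piece (i + 2)).mem_a
    obtain ⟨_, R⟩ := (h.piece (i + 1)).start _ (h.piece (i + 1)).mem_b
    refine h.isTraceable i (((Q.symm.trans (h.spoke (i + 2)).symm (single K x)).trans
      hadj hP).trans (h.link i) R) ?_
    abel

theorem isTraceable_of_adj_x_b (hadj : K.Adj x (b i)) : K.IsTraceable := by
  obtain ⟨m, hm, P⟩ := (h.piece i).path_ac
  obtain ⟨_, Q⟩ := (h.piece (i + 1)).start _ (h.piece (i + 1)).mem_b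
  obtain ⟨_, R⟩ := (h.piece (i + 2)).start _ (h.piece (i + 2)).mem_c
  refine h.isTraceable i ((((Q.symm.trans (h.link i).symm P.symm).trans
    (h.spoke i).symm (single K x)).trans hadj (single K _)).trans (h.link₂ i).symm R) ?_
  rw [← hm]
  abel

theorem isTraceable_of_adj_x_c (hadj : K.Adj x (c i)) : K.IsTraceable := by
  obtain ⟨m, hm, P⟩ := (h.piece i).path_ab
  obtain ⟨_, Q⟩ := (h.piece (i + 1)).start _ (h.piece (i + 1)).mem_b
  obtain ⟨_, R⟩ := (h.piece (i + 2)).start _ (h.piece (i + 2)).mem_c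
  refine h.isTraceable i ((((Q.symm.trans (h.link i).symm (single K _)).trans
    hadj.symm (single K x)).trans (h.spoke i) P).trans (h.link₂ i).symm R) ?_
  rw [← hm]
  abel

/-- The new edge leads from the next piece into this one, which is left through `a i` and `x` for
the third piece. -/
theorem isTraceable_of_adj_of_hasPath_left {u v : X} (hadj : K.Adj u v)
    (hP : K.HasPath (M i) u (a i)) (hv : v ∈ M (i + 1)) : K.IsTraceable := by
  obtain ⟨_, Q⟩ := (h.piece (i + 1)).start _ hv
  obtain ⟨_, R⟩ := (h.piece (i + 2)).start _ (h.piece (i + 2)).mem_a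
  refine h.isTraceable i (((Q.symm.trans hadj.symm hP).trans
    (h.spoke i).symm (single K x)).trans (h.spoke (i + 2)) R) ?_
  abel

theorem isTraceable_of_adj_of_hasPath_right {u v : X} (hadj : K.Adj u v)
    (hP : K.HasPath (M (i + 1)) v (a (i + 1))) (hu : u ∈ M i) : K.IsTraceable := by
  obtain ⟨_, Q⟩ := (h.piece i).start _ hu
  obtain ⟨_, R⟩ := (h.piece (i + 2)).start _ (h.piece (i + 2)).mem_a
  refine h.isTraceable i (((Q.symm.trans hadj hP).trans
    (h.spoke (i + 1)).symm (single K x)).trans (h.spoke (i + 2)) R) ?_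
  abel

/-- In this lemma and the seven after it, the ends of the new edge are the terminals dropped from
their pieces. The third piece also drops a terminal, and the dropped ones are visited separately as
singletons. -/
theorem isTraceable_of_adj_a_a (hadj : K.Adj (a i) (a (i + 1))) : K.IsTraceable := by
  obtain ⟨k, hk, P⟩ := (h.piece i).path_bc
  obtain ⟨m, hm, Q⟩ := (h.piece (i + 1)).path_bc
  obtain ⟨n, hn, R⟩ := (h.piece (i + 2)).path_ab
  refine h.isTraceable i (((single K _).trans hadj.symm (single K _)).trans (h.spoke i).symm
    (single K x) |>.trans (h.spoke (i + 2)) R |>.trans (h.link₁ i).symm Q.symm |>.trans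
    (h.link i).symm P.symm |>.trans (h.link₂ i).symm (single K _)) ?_
  rw [← hk, ← hm, ← hn]
  abel

theorem isTraceable_of_adj_a_b (hadj : K.Adj (a i) (b (i + 1))) : K.IsTraceable := by
  obtain ⟨k, hk, P⟩ := (h.piece i).path_bc
  obtain ⟨m, hm, Q⟩ := (h.piece (i + 1)).path_ac
  obtain ⟨n, hn, R⟩ := (h.piece (i + 2)).path_bc
  refine h.isTraceable i ((single K _).trans (h.spoke (i + 2)).symm (single K x) |>.trans
    (h.spoke (i + 1)) Q |>.trans (h.link₁ i) R |>.trans (h.link₂ i) P |>.trans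
    (h.link i) (single K _) |>.trans hadj.symm (single K _)) ?_
  rw [← hk, ← hm, ← hn]
  abel

theorem isTraceable_of_adj_c_a (hadj : K.Adj (c i) (a (i + 1))) : K.IsTraceable := by
  obtain ⟨k, hk, P⟩ := (h.piece i).path_ab
  obtain ⟨m, hm, Q⟩ := (h.piece (i + 1)).path_bc
  obtain ⟨n, hn, R⟩ := (h.piece (i + 2)).path_bc
  refine h.isTraceable i ((single K _).trans (h.spoke (i + 2)).symm (single K x) |>.trans
    (h.spoke i) P |>.trans (h.link₂ i).symm R.symm |>.trans (h.link₁ i).symm Q.symm |>.trans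
    (h.link i).symm (single K _) |>.trans hadj (single K _)) ?_
  rw [← hk, ← hm, ← hn]
  abel

theorem isTraceable_of_adj_a_c (hadj : K.Adj (a i) (c (i + 1))) : K.IsTraceable := by
  obtain ⟨k, hk, P⟩ := (h.piece i).path_bc
  obtain ⟨m, hm, Q⟩ := (h.piece (i + 1)).path_ab
  obtain ⟨n, hn, R⟩ := (h.piece (i + 2)).path_ab
  refine h.isTraceable i ((single K _).trans (h.link₂ i) P |>.trans (h.link i) Q.symm |>.trans
    (h.spoke (i + 1)).symm (single K x) |>.trans (h.spoke i) (single K _) |>.trans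
    hadj (single K _) |>.trans (h.link₁ i) R.symm) ?_
  rw [← hk, ← hm, ← hn]
  abel

theorem isTraceable_of_adj_b_a (hadj : K.Adj (b i) (a (i + 1))) : K.IsTraceable := by
  obtain ⟨k, hk, P⟩ := (h.piece i).path_ac
  obtain ⟨m, hm, Q⟩ := (h.piece (i + 1)).path_bc
  obtain ⟨n, hn, R⟩ := (h.piece (i + 2)).path_ac
  refine h.isTraceable i ((single K _).trans (h.link₁ i).symm Q.symm |>.trans
    (h.link i).symm P.symm |>.trans (h.spoke i).symm (single K x) |>.trans
    (h.spoke (i + 1)) (single K _) |>.trans hadj.symm (single K _) |>.trans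
    (h.link₂ i).symm R.symm) ?_
  rw [← hk, ← hm, ← hn]
  abel

theorem isTraceable_of_adj_b_b (hadj : K.Adj (b i) (b (i + 1))) : K.IsTraceable := by
  obtain ⟨k, hk, P⟩ := (h.piece i).path_ac
  obtain ⟨m, hm, Q⟩ := (h.piece (i + 1)).path_ac
  obtain ⟨n, hn, R⟩ := (h.piece (i + 2)).path_ab
  refine h.isTraceable i ((single K _).trans (h.link₂ i) (single K _) |>.trans
    hadj (single K _) |>.trans (h.link i).symm P.symm |>.trans (h.spoke i).symm (single K x) |>.trans
    (h.spoke (i + 1)) Q |>.trans (h.link₁ i) R.symm) ?_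
  rw [← hk, ← hm, ← hn]
  abel

theorem isTraceable_of_adj_c_c (hadj : K.Adj (c i) (c (i + 1))) : K.IsTraceable := by
  obtain ⟨k, hk, P⟩ := (h.piece i).path_ab
  obtain ⟨m, hm, Q⟩ := (h.piece (i + 1)).path_ab
  obtain ⟨n, hn, R⟩ := (h.piece (i + 2)).path_ac
  refine h.isTraceable i ((single K _).trans (h.link₁ i).symm (single K _) |>.trans
    hadj.symm (single K _) |>.trans (h.link i) Q.symm |>.trans
    (h.spoke (i + 1)).symm (single K x) |>.trans (h.spoke i) P |>.trans
    (h.link₂ i).symm R.symm) ?_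
  rw [← hk, ← hm, ← hn]
  abel

theorem isTraceable_of_adj_b_c (hadj : K.Adj (b i) (c (i + 1))) : K.IsTraceable := by
  obtain ⟨k, hk, P⟩ := (h.piece i).path_ac
  obtain ⟨m, hm, Q⟩ := (h.piece (i + 1)).path_ab
  obtain ⟨n, hn, R⟩ := (h.piece (i + 2)).path_ab
  refine h.isTraceable i ((single K _).trans (h.link₂ i) (single K _) |>.trans
    hadj (single K _) |>.trans (h.link₁ i) R.symm |>.trans (h.spoke (i + 2)).symm (single K x)
    |>.trans (h.spoke i) P |>.trans (h.link i) Q.symm) ?_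
  rw [← hk, ← hm, ← hn]
  abel

theorem isTraceable_of_adj_terminals {u v : X} (hadj : K.Adj u v)
    (hu : u = a i ∨ u = b i ∨ u = c i)
    (hv : v = a (i + 1) ∨ v = b (i + 1) ∨ v = c (i + 1))
    (huv : ¬ (u = c i ∧ v = b (i + 1))) : K.IsTraceable := by
  rcases hu with rfl | rfl | rfl <;> rcases hv with rfl | rfl | rfl
  · exact h.isTraceable_of_adj_a_a i hadj
  · exact h.isTraceable_of_adj_a_b i hadj
  · exact h.isTraceable_of_adj_a_c i hadj
  · exact h.isTraceable_of_adj_b_a i hadj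
  · exact h.isTraceable_of_adj_b_b i hadj
  · exact h.isTraceable_of_adj_b_c i hadj
  · exact h.isTraceable_of_adj_c_a i hadj
  · exact absurd ⟨rfl, rfl⟩ huv
  · exact h.isTraceable_of_adj_c_c i hadj

end IsK4Frame

end SimpleGraph

/-! ### Paths in a single graph with one vertex opened up -/

namespace SimpleGraph

section OneGraph

variable {V : Type*} [Fintype V] [DecidableEq V] {H : SimpleGraph V} {z a b c : V}

omit [DecidableEq V] in
theorem isCubic_iff_ncard_neighborSet : H.IsCubic ↔ ∀ v, (H.neighborSet v).ncard = 3 := by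
  classical
  refine forall_congr' fun v => ?_
  rw [← card_neighborSet_eq_degree, Set.ncard_eq_toFinset_card', Set.toFinset_card]

omit [DecidableEq V] in
theorem IsCubic.distinct (hH : H.IsCubic) (hN : H.neighborSet z = {a, b, c}) :
    a ≠ b ∧ a ≠ c ∧ b ≠ c := by
  have h3 := isCubic_iff_ncard_neighborSet.1 hH z
  rw [hN] at h3
  have h2 : ∀ x y : V, ({x, y} : Set V).ncard ≤ 2 := fun x y => Set.ncard_insert_le x {y} |>.trans
    (by simp)
  refine ⟨?_, ?_, ?_⟩ <;> rintro rfl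
  · have := h2 a c
    simp_all
  · have := h2 b a
    rw [Set.insert_comm] at h3
    simp_all
  · have := h2 a b
    simp_all

omit [DecidableEq V] in
theorem IsCubic.three_le_card (hH : H.IsCubic) (z : V) : 3 ≤ Fintype.card V := by
  rw [← isCubic_iff_ncard_neighborSet.1 hH z, ← Nat.card_eq_fintype_card]
  exact Set.ncard_le_card _

omit [DecidableEq V] [Fintype V] in
theorem adj_iff_of_neighborSet_eq (hN : H.neighborSet z = {a, b, c}) (v : V) :
    H.Adj z v ↔ v = a ∨ v = b ∨ v = c := by
  rw [← mem_neighborSet, hN]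
  simp

/-- A hamiltonian cycle of `H - r` passes through `z`, whose only remaining neighbours are `p` and
`q`. -/
theorem exists_hasPath_avoiding {p q r : V} (hcard : 3 ≤ Fintype.card V)
    (hH : H.IsHypohamiltonian) (hN : ∀ v, H.Adj z v ↔ v = p ∨ v = q ∨ v = r) :
    ∃ m, {r} + m = Finset.univ.val.erase z ∧ H.HasPath m p q := by
  have hzr : H.Adj z r := (hN r).2 (by simp)
  obtain ⟨s, t, hst, hsr, htr, hs, ht, hP⟩ := exists_hasPath_of_induce_ne hcard hzr.ne (hH.2 r)
  refine ⟨(Finset.univ.val.erase z).erase r, ?_, ?_⟩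
  · rw [Multiset.singleton_add, Multiset.cons_erase]
    rw [Multiset.mem_erase_of_ne hzr.ne']
    simp
  · rcases (hN s).1 hs with rfl | rfl | rfl <;> rcases (hN t).1 ht with rfl | rfl | rfl <;>
      first
        | exact hP
        | exact hP.symm
        | contradiction

theorem IsHypohamiltonian.isPiece (hcard : 3 ≤ Fintype.card V)
    (hH : H.IsHypohamiltonian) (hN : ∀ v, H.Adj z v ↔ v = a ∨ v = b ∨ v = c) :
    H.IsPiece (Finset.univ.val.erase z) a b c where
  start p hp := exists_hasPath_erase hcard ((Finset.univ.nodup.mem_erase_iff).1 hp).1 (hH.2 z)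
  path_ab := exists_hasPath_avoiding hcard hH hN
  path_ac := exists_hasPath_avoiding hcard hH fun v => by rw [hN]; tauto
  path_bc := exists_hasPath_avoiding hcard hH fun v => by rw [hN]; tauto

omit [Fintype V] [DecidableEq V] in
theorem sup_edge_adj_of_ne {u v x y : V} (hx : x ≠ u) (hy : y ≠ u) :
    (H ⊔ edge u v).Adj x y ↔ H.Adj x y := by
  rw [sup_adj, edge_adj]
  simp [hx, hy]

/-- The cycle must use the added edge `zu`, since otherwise it would lie in `H`. Its other edge at
`z` belongs to `H` and leads to `t`. -/
theorem exists_hasPath_of_isHamiltonianCycle {u w : V} (hH : ¬ H.IsHamiltonian)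
    (huz : u ≠ z) {p : (H ⊔ edge z u).Walk w w} (hp : p.IsHamiltonianCycle) :
    ∃ t, H.Adj z t ∧ H.HasPath (Finset.univ.val.erase z) u t ∧
      ∀ y, H.Adj z y → y ≠ u → (s(y, z) ∈ p.edges ↔ y = t) := by
  obtain ⟨s, t, hst, hs, ht, hP, hE⟩ := hp.exists_hasPath z
  replace hP : H.HasPath (Finset.univ.val.erase z) s t := by
    refine hP.imp fun x hx y hy hxy => ?_
    exact (sup_edge_adj_of_ne ((Finset.univ.nodup.mem_erase_iff).1 hx).1
      ((Finset.univ.nodup.mem_erase_iff).1 hy).1).1 hxy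
  have hadj : ∀ y, (H ⊔ edge z u).Adj z y → y ≠ u → H.Adj z y := by
    intro y hy hyu
    rw [sup_adj, edge_adj] at hy
    rcases hy with hy | ⟨⟨-, rfl⟩ | ⟨h, -⟩, -⟩
    · exact hy
    · exact absurd rfl hyu
    · exact absurd h.symm huz
  by_cases hsu : s = u
  · subst hsu
    refine ⟨t, hadj t ht hst.symm, hP, fun y _ hyu => ?_⟩
    rw [hE]
    simp [hyu]
  by_cases htu : t = u
  · subst htu
    refine ⟨s, hadj s hs hsu, hP.symm, fun y _ hyu => ?_⟩
    rw [hE]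
    simp [hyu]
  · exact absurd (hP.isHamiltonian (hadj s hs hsu) (hadj t ht htu) hst) hH

/-- Besides `zu`, each cycle has one edge at `z`: it is `az` for the first cycle, and `bz` or `cz`
for the second. -/
theorem ConditionC.exists_hasPath {u : V} (hC : H.ConditionC z a) (hH : ¬ H.IsHamiltonian)
    (hN : ∀ v, H.Adj z v ↔ v = a ∨ v = b ∨ v = c) (huz : u ≠ z) (hu : ¬ H.Adj z u) :
    H.HasPath (Finset.univ.val.erase z) u a ∧
      ∃ t, (t = b ∨ t = c) ∧ H.HasPath (Finset.univ.val.erase z) u t := by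
  have haz : H.Adj z a := (hN a).2 (by simp)
  have hau : a ≠ u := by
    rintro rfl
    exact hu haz
  obtain ⟨⟨w, p, hp, hpa⟩, ⟨w', q, hq, hqa⟩⟩ := hC u huz hu
  obtain ⟨t, ht, hP, hE⟩ := exists_hasPath_of_isHamiltonianCycle hH huz hp
  obtain ⟨t', ht', hQ, hE'⟩ := exists_hasPath_of_isHamiltonianCycle hH huz hq
  rw [hE a haz hau] at hpa
  rw [hE' a haz hau] at hqa
  refine ⟨hpa ▸ hP, t', ?_, hQ⟩
  exact ((hN t').1 ht').resolve_left fun h => hqa h.symm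

theorem IsMaximalNonhamiltonian.exists_hasPath {u v : V} (hcard : 3 ≤ Fintype.card V)
    (hH : H.IsMaximalNonhamiltonian) (huz : u ≠ z) (hvz : v ≠ z) (huv : Hᶜ.Adj u v) :
    ∃ s t, s ≠ t ∧ H.Adj z s ∧ H.Adj z t ∧
      (H ⊔ edge u v).HasPath (Finset.univ.val.erase z) s t := by
  obtain ⟨w, p, hp⟩ := hH.2 u v huv (by omega)
  obtain ⟨s, t, hst, hs, ht, hP, -⟩ := hp.exists_hasPath z
  refine ⟨s, t, hst, ?_, ?_, hP⟩
  · rw [sup_adj, edge_adj] at hs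
    simpa [huz.symm, hvz.symm] using hs
  · rw [sup_adj, edge_adj] at ht
    simpa [huz.symm, hvz.symm] using ht

omit [Fintype V] [DecidableEq V] in
theorem IsPiece.map {X : Type*} {K : SimpleGraph X} {M : Multiset V} (f : V → X)
    (hf : ∀ x ∈ M, ∀ y ∈ M, H.Adj x y → K.Adj (f x) (f y)) (h : H.IsPiece M a b c) :
    K.IsPiece (M.map f) (f a) (f b) (f c) := by
  have key : ∀ r p q, (∃ m, {r} + m = M ∧ H.HasPath m p q) →
      ∃ m, {f r} + m = M.map f ∧ K.HasPath m (f p) (f q) := by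
    rintro r p q ⟨m, rfl, hP⟩
    exact ⟨m.map f, by simp, hP.map f fun x hx y hy =>
      hf x (Multiset.mem_add.2 (.inr hx)) y (Multiset.mem_add.2 (.inr hy))⟩
  refine ⟨fun p hp => ?_, key _ _ _ h.path_ab, key _ _ _ h.path_ac, key _ _ _ h.path_bc⟩
  obtain ⟨p, hp', rfl⟩ := Multiset.mem_map.1 hp
  obtain ⟨q, hP⟩ := h.start p hp'
  exact ⟨f q, hP.map f hf⟩

end OneGraph

theorem HasPath.of_isChain {X : Type*} {K : SimpleGraph X} {l : List X} (hne : l ≠ [])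
    (hl : l.IsChain K.Adj) : K.HasPath l (l.head hne) (l.getLast hne) :=
  ⟨.ofSupport l hne hl, by rw [Walk.support_ofSupport]⟩

end SimpleGraph

/-! ### Adjacency, regularity and nontraceability of the inflated K_4 -/

section Inflated

open SimpleGraph

variable {V : Fin 3 → Type*}

namespace InflatedK4Vertex

/-- The index of the part containing a vertex other than the new one. -/
def part {z : ∀ i, V i} (y : InflatedK4Vertex z) : Option (Fin 3) := y.map Sigma.fst

variable [∀ i, DecidableEq (V i)]

/-- The vertices of `Hᵢ` as vertices of the inflated `K₄`, with `zᵢ` sent to the new vertex. -/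
def emb (z : ∀ i, V i) (i : Fin 3) (v : V i) : InflatedK4Vertex z :=
  if h : v = z i then none else some ⟨i, v, h⟩

variable {z : ∀ i, V i} {i : Fin 3}

theorem emb_of_ne {v : V i} (h : v ≠ z i) : emb z i v = some ⟨i, v, h⟩ := dif_neg h

theorem emb_injective : Function.Injective (emb z i) := by
  intro v w h
  unfold emb at h
  split_ifs at h with h1 h2 h2
  · rw [h1, h2]
  · simpa using h

theorem part_emb {v : V i} (h : v ≠ z i) : (emb z i v).part = some i := by
  rw [emb_of_ne h]
  rfl

theorem exists_emb_of_part_eq {y : InflatedK4Vertex z} (h : y.part = some i) :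
    ∃ v, v ≠ z i ∧ y = emb z i v := by
  rcases y with _ | ⟨j, v, hv⟩
  · cases h
  · obtain rfl : j = i := by simpa [part] using h
    exact ⟨v, hv, (emb_of_ne hv).symm⟩

variable [∀ i, Fintype (V i)]

/-- The vertices of the `i`-th part. -/
def verts (z : ∀ i, V i) (i : Fin 3) : Multiset (InflatedK4Vertex z) :=
  (Finset.univ.val.erase (z i)).map (emb z i)

theorem mem_verts {y : InflatedK4Vertex z} : y ∈ verts z i ↔ y.part = some i := by
  unfold verts
  constructor
  · intro h
    obtain ⟨v, hv, rfl⟩ := Multiset.mem_map.1 h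
    exact part_emb ((Finset.univ.nodup.mem_erase_iff).1 hv).1
  · intro h
    obtain ⟨v, hv, rfl⟩ := exists_emb_of_part_eq h
    exact Multiset.mem_map_of_mem _ ((Finset.univ.nodup.mem_erase_iff).2 ⟨hv, by simp⟩)

theorem nodup_verts : (verts z i).Nodup :=
  (Finset.univ.nodup.erase _).map emb_injective

theorem cover_verts (i : Fin 3) :
    {none} + verts z i + verts z (i + 1) + verts z (i + 2) = Finset.univ.val := by
  refine (Multiset.Nodup.ext ?_ Finset.univ.nodup).2 fun y => ?_
  · have hne : i ≠ i + 1 ∧ i ≠ i + 2 ∧ i + 1 ≠ i + 2 := by decide +revert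
    simp only [Multiset.nodup_add, Multiset.nodup_singleton, nodup_verts, true_and,
      Multiset.disjoint_left, Multiset.mem_add, mem_verts, Multiset.mem_singleton]
    refine ⟨⟨?_, ?_⟩, ?_⟩
    · rintro y rfl h
      cases h
    · rintro y (rfl | h) h'
      · cases h'
      · exact hne.1 (Option.some.inj (h.symm.trans h'))
    · rintro y ((rfl | h) | h) h'
      · cases h'
      · exact hne.2.1 (Option.some.inj (h.symm.trans h'))
      · exact hne.2.2 (Option.some.inj (h.symm.trans h'))
  · simp only [Multiset.mem_add, mem_verts, Multiset.mem_singleton]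
    refine iff_of_true ?_ (Finset.mem_univ y)
    rcases y with _ | ⟨j, v⟩
    · simp
    · have : j = i ∨ j = i + 1 ∨ j = i + 2 := by decide +revert
      rcases this with h | h | h <;> simp [part, h]

end InflatedK4Vertex

open InflatedK4Vertex

variable {H : ∀ i, SimpleGraph (V i)} {z a b c : ∀ i, V i} [∀ i, DecidableEq (V i)]

theorem inflatedK4_adj_inner {i : Fin 3} {v w : V i} (hv : v ≠ z i) (hw : w ≠ z i)
    (h : (H i).Adj v w) : (inflatedK4 H z a b c).Adj (emb z i v) (emb z i w) := by
  rw [emb_of_ne hv, emb_of_ne hw]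
  exact (fromRel_adj _ _ _).2 ⟨by simpa using h.ne, .inl (.inner i ⟨v, hv⟩ ⟨w, hw⟩ h)⟩

theorem inflatedK4_adj_spoke (i : Fin 3) (h : a i ≠ z i) :
    (inflatedK4 H z a b c).Adj none (emb z i (a i)) := by
  rw [emb_of_ne h]
  exact (fromRel_adj _ _ _).2 ⟨by simp, .inl (.spoke i h)⟩

theorem inflatedK4_adj_link (i : Fin 3) (h : c i ≠ z i) (h' : b (i + 1) ≠ z (i + 1)) :
    (inflatedK4 H z a b c).Adj (emb z i (c i)) (emb z (i + 1) (b (i + 1))) := by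
  rw [emb_of_ne h, emb_of_ne h']
  refine (fromRel_adj _ _ _).2 ⟨fun h => ?_, .inl (.link i h h')⟩
  have hne : ∀ i : Fin 3, i ≠ i + 1 := by decide
  exact hne i (congrArg Sigma.fst (Option.some.inj h))

/-- The neighbour outside the `i`-th part of a vertex adjacent to `zᵢ`. -/
def outerNeighbor (z a b c : ∀ i, V i) (i : Fin 3) (v : V i) : InflatedK4Vertex z :=
  if v = a i then none
  else if v = b i then emb z (i + 2) (c (i + 2)) else emb z (i + 1) (b (i + 1))

/-- Neighbours of `v` in `Hᵢ` as neighbours of `v` in the inflated `K₄`. -/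
def liftNeighbor (z a b c : ∀ i, V i) (i : Fin 3) (v w : V i) : InflatedK4Vertex z :=
  if w = z i then outerNeighbor z a b c i v else emb z i w

/-- The vertices `aᵢ`, `bᵢ`, `cᵢ` are the three distinct neighbours of `zᵢ`. -/
structure IsOpening (H : ∀ i, SimpleGraph (V i)) (z a b c : ∀ i, V i) : Prop where
  adj_iff : ∀ i v, (H i).Adj (z i) v ↔ v = a i ∨ v = b i ∨ v = c i
  ab : ∀ i, a i ≠ b i
  ac : ∀ i, a i ≠ c i
  bc : ∀ i, b i ≠ c i

namespace IsOpening

section Adj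

variable (h : IsOpening H z a b c) (i : Fin 3)
include h

omit [∀ i, DecidableEq (V i)] in
theorem adj_a : (H i).Adj (z i) (a i) := (h.adj_iff i _).2 (by simp)
omit [∀ i, DecidableEq (V i)] in
theorem adj_b : (H i).Adj (z i) (b i) := (h.adj_iff i _).2 (by simp)
omit [∀ i, DecidableEq (V i)] in
theorem adj_c : (H i).Adj (z i) (c i) := (h.adj_iff i _).2 (by simp)

omit h in
theorem outerNeighbor_a : outerNeighbor z a b c i (a i) = none := if_pos rfl

theorem outerNeighbor_b : outerNeighbor z a b c i (b i) = emb z (i + 2) (c (i + 2)) := by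
  rw [outerNeighbor, if_neg (h.ab i).symm, if_pos rfl]

theorem outerNeighbor_c : outerNeighbor z a b c i (c i) = emb z (i + 1) (b (i + 1)) := by
  rw [outerNeighbor, if_neg (h.ac i).symm, if_neg (h.bc i).symm]

theorem part_outerNeighbor_ne (v : V i) : (outerNeighbor z a b c i v).part ≠ some i := by
  unfold outerNeighbor
  split_ifs
  · simp [part]
  · rw [part_emb (h.adj_c _).ne']
    simp
  · rw [part_emb (h.adj_b _).ne']
    simp

theorem adj_none_iff (y : InflatedK4Vertex z) :
    (inflatedK4 H z a b c).Adj none y ↔ ∃ i, emb z i (a i) = y := by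
  constructor
  · intro hy
    rcases ((fromRel_adj _ _ _).1 hy).2 with hr | hr
    · cases hr with
      | spoke i hi => exact ⟨i, emb_of_ne hi⟩
    · cases hr
  · rintro ⟨i, rfl⟩
    exact inflatedK4_adj_spoke i (h.adj_a i).ne'

theorem adj_emb_iff {v : V i} (hv : v ≠ z i) (y : InflatedK4Vertex z) :
    (inflatedK4 H z a b c).Adj (emb z i v) y ↔
      ∃ w, (H i).Adj v w ∧ liftNeighbor z a b c i v w = y := by
  constructor
  · intro hy
    rw [emb_of_ne hv] at hy
    rcases ((fromRel_adj _ _ _).1 hy).2 with hr | hr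
    · cases hr with
      | inner i _ w hvw => exact ⟨w, hvw, by rw [liftNeighbor, if_neg w.2, emb_of_ne w.2]⟩
      | link i hc hb =>
        exact ⟨z i, (h.adj_c i).symm, by
          rw [liftNeighbor, if_pos rfl, h.outerNeighbor_c, emb_of_ne hb]⟩
    · generalize hx : (⟨v, hv⟩ : {v : V i // v ≠ z i}) = x at hr
      obtain rfl : v = x := congrArg Subtype.val hx
      cases hr with
      | inner i w _ hvw => exact ⟨w, hvw.symm, by rw [liftNeighbor, if_neg w.2, emb_of_ne w.2]⟩
      | spoke i ha =>
        exact ⟨z i, (h.adj_a i).symm, by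
          rw [liftNeighbor, if_pos rfl, outerNeighbor_a]⟩
      | link j hc hb =>
        refine ⟨z (j + 1), (h.adj_b (j + 1)).symm, ?_⟩
        rw [liftNeighbor, if_pos rfl, h.outerNeighbor_b, show j + 1 + 2 = j by omega, emb_of_ne hc]
  · rintro ⟨w, hvw, rfl⟩
    by_cases hw : w = z i
    · subst hw
      rw [liftNeighbor, if_pos rfl]
      rcases (h.adj_iff i v).1 hvw.symm with rfl | rfl | rfl
      · rw [outerNeighbor_a]
        exact (inflatedK4_adj_spoke i hv).symm
      · rw [h.outerNeighbor_b]
        have := inflatedK4_adj_link (H := H) (a := a) (i + 2) (h.adj_c _).ne' (h.adj_b _).ne'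
        rw [show i + 2 + 1 = i by omega] at this
        exact this.symm
      · rw [h.outerNeighbor_c]
        exact inflatedK4_adj_link i hv (h.adj_b _).ne'
    · rw [liftNeighbor, if_neg hw]
      exact inflatedK4_adj_inner hv hw hvw

/-- Neighbours other than `z i` are sent into part `i`, while `z i` is sent outside it. Together
with `adj_emb_iff`, this matches the neighbours of `v` in the two graphs and so preserves its
degree. -/
theorem liftNeighbor_injective (v : V i) : Function.Injective (liftNeighbor z a b c i v) := by
  intro w w' hww
  unfold liftNeighbor at hww
  split_ifs at hww with h1 h2 h2
  · rw [h1, h2]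
  · exact absurd (hww ▸ part_emb h2) (h.part_outerNeighbor_ne i v)
  · exact absurd (hww ▸ part_emb h1) (h.part_outerNeighbor_ne i v)
  · exact emb_injective hww

theorem adj_of_emb_adj {v w : V i} (hv : v ≠ z i) (hw : w ≠ z i)
    (hvw : (inflatedK4 H z a b c).Adj (emb z i v) (emb z i w)) : (H i).Adj v w := by
  obtain ⟨w', hw', he⟩ := (h.adj_emb_iff i hv _).1 hvw
  have : liftNeighbor z a b c i v w = emb z i w := if_neg hw
  rwa [← h.liftNeighbor_injective i v (he.trans this.symm)]

theorem adj_z_of_adj_outer {p y : InflatedK4Vertex z} (hp : p.part = some i)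
    (hy : y.part ≠ some i) (hpy : (inflatedK4 H z a b c).Adj p y) :
    ∃ v, (H i).Adj (z i) v ∧ p = emb z i v ∧ y = outerNeighbor z a b c i v := by
  obtain ⟨v, hv, rfl⟩ := exists_emb_of_part_eq hp
  obtain ⟨w, hvw, rfl⟩ := (h.adj_emb_iff i hv _).1 hpy
  by_cases hw : w = z i
  · subst hw
    exact ⟨v, hvw.symm, rfl, if_pos rfl⟩
  · rw [liftNeighbor, if_neg hw, part_emb hw] at hy
    exact absurd rfl hy

end Adj

variable [∀ i, Fintype (V i)]

theorem isCubic (h : IsOpening H z a b c) (hcubic : ∀ i, (H i).IsCubic) :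
    (inflatedK4 H z a b c).IsCubic := by
  rw [isCubic_iff_ncard_neighborSet]
  rintro (_ | ⟨i, v, hv⟩)
  · have : (inflatedK4 H z a b c).neighborSet none = (fun i => emb z i (a i)) '' Set.univ := by
      ext y
      simp [h.adj_none_iff]
    rw [this, Set.ncard_image_of_injective, Set.ncard_univ, Nat.card_fin]
    intro i j hij
    have := congrArg part hij
    simpa [part_emb (h.adj_a _).ne'] using this
  · have : (inflatedK4 H z a b c).neighborSet (some ⟨i, v, hv⟩) =
        liftNeighbor z a b c i v '' (H i).neighborSet v := by
      ext y
      rw [← emb_of_ne hv, mem_neighborSet, h.adj_emb_iff i hv]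
      rfl
    rw [this, Set.ncard_image_of_injective _ (h.liftNeighbor_injective i v)]
    exact isCubic_iff_ncard_neighborSet.1 (hcubic i) v

theorem not_isTraceable (h : IsOpening H z a b c) (hH : ∀ i, ¬ (H i).IsHamiltonian) :
    ¬ (inflatedK4 H z a b c).IsTraceable := by
  rintro ⟨u, v, p, hp⟩
  -- Two ends cannot occupy three parts; the new vertex, with `part` equal to `none`, occupies none
  -- of them.
  obtain ⟨i, hu, hv⟩ : ∃ i, u.part ≠ some i ∧ v.part ≠ some i := by
    generalize u.part = s
    generalize v.part = t
    decide +revert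
  have hT : ∀ p y : InflatedK4Vertex z, p.part = some i → ¬ y.part = some i →
      (inflatedK4 H z a b c).Adj p y →
      p ∈ ({emb z i (a i), emb z i (b i), emb z i (c i)} : Set (InflatedK4Vertex z)) := by
    intro p y hp hy hpy
    obtain ⟨v, hv, rfl, -⟩ := h.adj_z_of_adj_outer i hp hy hpy
    rcases (h.adj_iff i v).1 hv with rfl | rfl | rfl <;> simp
  have hout : ∀ p y y' : InflatedK4Vertex z, p.part = some i → ¬ y.part = some i →
      ¬ y'.part = some i → (inflatedK4 H z a b c).Adj p y →
      (inflatedK4 H z a b c).Adj p y' → y = y' := by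
    intro p y y' hp hy hy' hpy hpy'
    obtain ⟨v, -, rfl, rfl⟩ := h.adj_z_of_adj_outer i hp hy hpy
    obtain ⟨w, -, hvw, rfl⟩ := h.adj_z_of_adj_outer i hp hy' hpy'
    rw [emb_injective hvw]
  obtain ⟨s, hs, hch, hnd, hmem, h1, h2, h12⟩ := exists_segment hT hout p.isChain_adj_support
    hp.isPath.support_nodup (by simp) (by simpa using hu) (by simpa using hv)
    ⟨emb z i (a i), hp.mem_support _, part_emb (h.adj_a i).ne'⟩
  have hsM : (s : Multiset (InflatedK4Vertex z)) = verts z i := by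
    refine (Multiset.Nodup.ext (Multiset.coe_nodup.2 hnd) nodup_verts).2 fun y => ?_
    rw [Multiset.mem_coe, hmem, mem_verts]
    simp [hp.mem_support y]
  have hP := HasPath.of_isChain hs hch
  rw [hsM] at hP
  have key : ∀ y ∈ ({emb z i (a i), emb z i (b i), emb z i (c i)} : Set (InflatedK4Vertex z)),
      ∃ v, (H i).Adj (z i) v ∧ y = emb z i v := by
    rintro y (rfl | rfl | rfl)
    · exact ⟨_, h.adj_a i, rfl⟩
    · exact ⟨_, h.adj_b i, rfl⟩
    · exact ⟨_, h.adj_c i, rfl⟩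
  obtain ⟨v₁, hv₁, e₁⟩ := key _ h1
  obtain ⟨v₂, hv₂, e₂⟩ := key _ h2
  rw [e₁, e₂] at h12 hP
  have : Nonempty (V i) := ⟨z i⟩
  have hinv : ∀ v, Function.invFun (emb z i) (emb z i v) = v :=
    Function.leftInverse_invFun emb_injective
  -- The segment is pulled back to `H i` along a left inverse of `emb`.
  have hQ := hP.map (G' := H i) (Function.invFun (emb z i)) fun x hx y hy hxy => by
    obtain ⟨x', hx', rfl⟩ := exists_emb_of_part_eq (mem_verts.1 hx)
    obtain ⟨y', hy', rfl⟩ := exists_emb_of_part_eq (mem_verts.1 hy)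
    rw [hinv, hinv]
    exact h.adj_of_emb_adj i hx' hy' hxy
  rw [hinv, hinv, verts, Multiset.map_map] at hQ
  simp only [Function.comp_def, hinv, Multiset.map_id'] at hQ
  exact hH i (hQ.isHamiltonian hv₁ hv₂ fun h => h12 (by rw [h]))

theorem isK4Frame (h : IsOpening H z a b c) (hcard : ∀ i, 3 ≤ Fintype.card (V i))
    (hH : ∀ i, (H i).IsHypohamiltonian) :
    (inflatedK4 H z a b c).IsK4Frame none (verts z) (fun i => emb z i (a i))
      (fun i => emb z i (b i)) (fun i => emb z i (c i)) where
  piece i := ((hH i).isPiece (hcard i) (h.adj_iff i)).map _ fun _ hx _ hy hxy =>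
    inflatedK4_adj_inner ((Finset.univ.nodup.mem_erase_iff).1 hx).1
      ((Finset.univ.nodup.mem_erase_iff).1 hy).1 hxy
  spoke i := inflatedK4_adj_spoke i (h.adj_a i).ne'
  link i := inflatedK4_adj_link i (h.adj_c i).ne' (h.adj_b _).ne'
  cover := cover_verts

theorem hasPath_emb {K : SimpleGraph (InflatedK4Vertex z)} (hK : inflatedK4 H z a b c ≤ K)
    {i : Fin 3} {v w : V i} (hP : (H i).HasPath (Finset.univ.val.erase (z i)) v w) :
    K.HasPath (verts z i) (emb z i v) (emb z i w) :=
  hP.map _ fun _ hx _ hy hxy => hK (inflatedK4_adj_inner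
    ((Finset.univ.nodup.mem_erase_iff).1 hx).1 ((Finset.univ.nodup.mem_erase_iff).1 hy).1 hxy)

/-! ### Traceability after adding an edge -/

section AddEdge

variable (h : IsOpening H z a b c) (hcard : ∀ i, 3 ≤ Fintype.card (V i))
  (hH : ∀ i, (H i).IsMaximalHypohamiltonian) (hC : ∀ i, (H i).ConditionC (z i) (a i))
  {K : SimpleGraph (InflatedK4Vertex z)} (hK : inflatedK4 H z a b c ≤ K)
include h hcard hH hK

/-- `K` is any supergraph containing the new edge, so the edge may be read in either direction. -/
theorem isTraceable_of_adj_inner {i : Fin 3} {u v : V i} (hu : u ≠ z i) (hv : v ≠ z i)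
    (huv : ¬ (inflatedK4 H z a b c).Adj (emb z i u) (emb z i v))
    (hadj : K.Adj (emb z i u) (emb z i v)) : K.IsTraceable := by
  have hF := (h.isK4Frame hcard fun i => (hH i).2).mono hK
  have hc : (H i)ᶜ.Adj u v := by
    rw [compl_adj]
    refine ⟨?_, fun huv' => huv (inflatedK4_adj_inner hu hv huv')⟩
    rintro rfl
    exact hadj.ne rfl
  obtain ⟨s, t, hst, hs, ht, hP⟩ := (hH i).1.exists_hasPath (hcard i) hu hv hc
  refine hF.isTraceable_of_hasPath i (fun he => hst (emb_injective he)) ?_ ?_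
    (hP.map (emb z i) fun x hx y hy hxy => ?_)
  · simpa only [emb_injective.eq_iff] using (h.adj_iff i s).1 hs
  · simpa only [emb_injective.eq_iff] using (h.adj_iff i t).1 ht
  · rw [sup_adj, edge_adj] at hxy
    rcases hxy with hxy | ⟨⟨rfl, rfl⟩ | ⟨rfl, rfl⟩, -⟩
    · exact hK (inflatedK4_adj_inner ((Finset.univ.nodup.mem_erase_iff).1 hx).1
        ((Finset.univ.nodup.mem_erase_iff).1 hy).1 hxy)
    · exact hadj
    · exact hadj.symm

include hC

theorem isTraceable_of_adj_none {i : Fin 3} {v : V i} (hv : v ≠ z i)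
    (huv : ¬ (inflatedK4 H z a b c).Adj none (emb z i v))
    (hadj : K.Adj none (emb z i v)) : K.IsTraceable := by
  have hF := (h.isK4Frame hcard fun i => (hH i).2).mono hK
  by_cases hz : (H i).Adj (z i) v
  · rcases (h.adj_iff i v).1 hz with rfl | rfl | rfl
    · exact absurd (inflatedK4_adj_spoke i hv) huv
    · exact hF.isTraceable_of_adj_x_b i hadj
    · exact hF.isTraceable_of_adj_x_c i hadj
  · obtain ⟨-, t, ht, hP⟩ := (hC i).exists_hasPath (hH i).2.1 (h.adj_iff i) hv hz
    refine hF.isTraceable_of_adj_x i hadj ?_ (hasPath_emb hK hP)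
    simpa only [emb_injective.eq_iff] using ht

theorem isTraceable_of_adj_succ {i : Fin 3} {u : V i} {v : V (i + 1)} (hu : u ≠ z i)
    (hv : v ≠ z (i + 1))
    (huv : ¬ (inflatedK4 H z a b c).Adj (emb z i u) (emb z (i + 1) v))
    (hadj : K.Adj (emb z i u) (emb z (i + 1) v)) : K.IsTraceable := by
  have hF := (h.isK4Frame hcard fun i => (hH i).2).mono hK
  by_cases hzu : (H i).Adj (z i) u
  · by_cases hzv : (H (i + 1)).Adj (z (i + 1)) v
    · refine hF.isTraceable_of_adj_terminals i hadj ?_ ?_ ?_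
      · simpa only [emb_injective.eq_iff] using (h.adj_iff i u).1 hzu
      · simpa only [emb_injective.eq_iff] using (h.adj_iff (i + 1) v).1 hzv
      · rintro ⟨h1, h2⟩
        rw [h1, h2] at huv
        exact huv (inflatedK4_adj_link i (h.adj_c i).ne' (h.adj_b _).ne')
    · have hP := ((hC (i + 1)).exists_hasPath (hH _).2.1 (h.adj_iff _) hv hzv).1
      exact hF.isTraceable_of_adj_of_hasPath_right i hadj (hasPath_emb hK hP)
        (mem_verts.2 (part_emb hu))
  · have hP := ((hC i).exists_hasPath (hH _).2.1 (h.adj_iff _) hu hzu).1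
    exact hF.isTraceable_of_adj_of_hasPath_left i hadj (hasPath_emb hK hP)
      (mem_verts.2 (part_emb hv))

theorem isTraceable_of_adj {u v : InflatedK4Vertex z} (huv : ¬ (inflatedK4 H z a b c).Adj u v)
    (hadj : K.Adj u v) : K.IsTraceable := by
  have huv' : ¬ (inflatedK4 H z a b c).Adj v u := fun h => huv h.symm
  rcases u with _ | ⟨i, u, hu⟩ <;> rcases v with _ | ⟨j, v, hv⟩
  · exact absurd rfl hadj.ne
  · rw [← emb_of_ne hv] at *
    exact h.isTraceable_of_adj_none hcard hH hC hK hv huv hadj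
  · rw [← emb_of_ne hu] at *
    exact h.isTraceable_of_adj_none hcard hH hC hK hu huv' hadj.symm
  · rw [← emb_of_ne hu, ← emb_of_ne hv] at *
    -- Modulo 3, distinct indices are cyclically consecutive in one order or the other, so edges
    -- between parts reduce to the successor case.
    have hij : j = i ∨ j = i + 1 ∨ i = j + 1 := by
      clear * -
      decide +revert
    rcases hij with rfl | rfl | rfl
    · exact h.isTraceable_of_adj_inner hcard hH hK hu hv huv hadj
    · exact h.isTraceable_of_adj_succ hcard hH hC hK hu hv huv hadj
    · exact h.isTraceable_of_adj_succ hcard hH hC hK hv hu huv' hadj.symm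

end AddEdge

end IsOpening

end Inflated

theorem mainTheorem2 {V : Fin 3 → Type*} [∀ i, Fintype (V i)] [∀ i, DecidableEq (V i)]
    (H : ∀ i, SimpleGraph (V i)) (z a b c : ∀ i, V i)
    (hcubic : ∀ i, (H i).IsCubic)
    (hMHH : ∀ i, (H i).IsMaximalHypohamiltonian)
    (hN : ∀ i, (H i).neighborSet (z i) = {a i, b i, c i})
    (hC : ∀ i, (H i).ConditionC (z i) (a i)) :
    (inflatedK4 H z a b c).IsCubic ∧ (inflatedK4 H z a b c).IsMaximalNontraceable := by
  have hO : IsOpening H z a b c :=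
    { adj_iff := fun i => SimpleGraph.adj_iff_of_neighborSet_eq (hN i)
      ab := fun i => ((hcubic i).distinct (hN i)).1
      ac := fun i => ((hcubic i).distinct (hN i)).2.1
      bc := fun i => ((hcubic i).distinct (hN i)).2.2 }
  refine ⟨hO.isCubic hcubic, hO.not_isTraceable fun i => (hMHH i).2.1, fun u v huv => ?_⟩
  refine hO.isTraceable_of_adj (fun i => (hcubic i).three_le_card (z i)) hMHH hC le_sup_left
    ((SimpleGraph.compl_adj _ _ _).1 huv).2 ?_
  rw [SimpleGraph.sup_adj, SimpleGraph.edge_adj]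
  exact .inr ⟨.inl ⟨rfl, rfl⟩, huv.ne⟩
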